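/- Let $k$ be a perfect field and let $d \in \mathbb{N} \cup \{\infty\}$. Let $\mathrm{Sch}^d/k$ be the category of separated schemes of finite type over $k$ of Krull dimension at most $d$, with the eh-topology, i.e. the Grothendieck topology on $\mathrm{Sch}^d/k$ generated by the étale coverings and by the families $(f\colon X'\to X,\ i\colon Z\to X)$ for all abstract blow-up squares in $\mathrm{Sch}^d/k$. Here an abstract blow-up square is a cartesian square $$\begin{array}{ccc} Z' & \xrightarrow{\ i'\ } & X' \\ {\scriptstyle f'}\downarrow & & \downarrow{\scriptstyle f} \\ Z & \xrightarrow{\ i\ } & X \end{array}$$ in which $f$ is proper, $i$ is a closed embedding, and $f$ induces an isomorphism $X'-Z' \xrightarrow{\sim} X-Z$. For an eh-sheaf of abelian groups $\mathcal F$ on $\mathrm{Sch}^d/k$ and $X \in \mathrm{Sch}^d/k$, let $H^n(X_{\mathrm{eh}},\mathcal F)$, $n \ge 0$, be the right derived functors of $\mathcal F \mapsto \Gamma(X_{\mathrm{eh}},\mathcal F)=\mathcal F(X)$. Then for every abstract blow-up square in $\mathrm{Sch}^d/k$ and every eh-sheaf of abelian groups $\mathcal F$ on $\mathrm{Sch}^d/k$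 there is a long exact sequence $$0 \to H^0(X_{\mathrm{eh}},\mathcal F) \to \cdots \to H^n(X_{\mathrm{eh}},\mathcal F) \xrightarrow{(i^*,f^*)} H^n(Z_{\mathrm{eh}},\mathcal F)\oplus H^n(X'_{\mathrm{eh}},\mathcal F) \xrightarrow{f'^*-i'^*} H^n(Z'_{\mathrm{eh}},\mathcal F) \to H^{n+1}(X_{\mathrm{eh}},\mathcal F) \to \cdots .$$ -/

import Mathlib

universe u

namespace EhTopology

open CategoryTheory Limits AlgebraicGeometry Opposite

/-! Schemes separated and of finite type over a field `k : Type u` form an essentially `u`-small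
category, so that sheafification and injective resolutions exist for sheaves in `Type u`. -/

/-- The quotient of a polynomial ring in finitely many variables by an ideal. -/
abbrev polyQuot (k : Type u) [Field k] (a : Σ n : ℕ, Ideal (MvPolynomial (Fin n) k)) : Type u :=
  MvPolynomial (Fin a.1) k ⧸ a.2

theorem exists_polyQuot_iso {k : Type u} [Field k] {Y : Scheme.{u}} [IsAffine Y]
    (g : Y ⟶ Spec (CommRingCat.of k)) [LocallyOfFiniteType g] :
    ∃ (a : Σ n : ℕ, Ideal (MvPolynomial (Fin n) k)),
      Nonempty (Spec (CommRingCat.of (polyQuot k a)) ≅ Y) := by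
  obtain ⟨φ, hφ⟩ := Spec.homEquiv.symm.surjective (Y.isoSpec.inv ≫ g)
  replace hφ : Spec.map φ = Y.isoSpec.inv ≫ g := hφ
  have : LocallyOfFiniteType (Spec.map φ) := by rw [hφ]; infer_instance
  have hft : RingHom.FiniteType φ.hom := HasRingHomProperty.Spec_iff.mp this
  algebraize [φ.hom]
  obtain ⟨n, f, hf⟩ := Algebra.FiniteType.iff_quotient_mvPolynomial''.mp
    (inferInstance : Algebra.FiniteType k Γ(Y, ⊤))
  let e := Ideal.quotientKerAlgEquivOfSurjective hf
  exact ⟨⟨n, RingHom.ker f⟩,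
    ⟨(Scheme.Spec.mapIso e.toRingEquiv.toCommRingCatIso.op).symm ≪≫ Y.isoSpec.symm⟩⟩

/-- Data which determine a scheme over `k`: two quotients `A`, `B` of polynomial rings, two ring
homomorphisms `A → B`, and the structure homomorphism `k → A`. -/
abbrev Presentation (k : Type u) [Field k] : Type u :=
  Σ a b : (Σ n : ℕ, Ideal (MvPolynomial (Fin n) k)),
    (polyQuot k a →+* polyQuot k b) × (polyQuot k a →+* polyQuot k b) × (k →+* polyQuot k a)

/-- `X` is covered by `Spec A`, and `Spec B` is the fibre product of `Spec A` with itself over `X`. -/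
def IsPresentedBy {k : Type u} [Field k] (X : Over (Spec (CommRingCat.of k)))
    (p : Presentation k) : Prop :=
  ∃ π : Spec (CommRingCat.of (polyQuot k p.1)) ⟶ X.left, EffectiveEpi π ∧
    π ≫ X.hom = Spec.map (CommRingCat.ofHom p.2.2.2.2) ∧
    IsPullback (Spec.map (CommRingCat.ofHom p.2.2.1)) (Spec.map (CommRingCat.ofHom p.2.2.2.1)) π π

theorem IsPresentedBy.exists_hom {k : Type u} [Field k] {X Y : Over (Spec (CommRingCat.of k))}
    {p : Presentation k} {πX : Spec (CommRingCat.of (polyQuot k p.1)) ⟶ X.left}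
    {πY : Spec (CommRingCat.of (polyQuot k p.1)) ⟶ Y.left} [EffectiveEpi πX]
    (hX : IsPullback (Spec.map (CommRingCat.ofHom p.2.2.1))
      (Spec.map (CommRingCat.ofHom p.2.2.2.1)) πX πX)
    (hY : IsPullback (Spec.map (CommRingCat.ofHom p.2.2.1))
      (Spec.map (CommRingCat.ofHom p.2.2.2.1)) πY πY) :
    ∃ f : X.left ⟶ Y.left, πX ≫ f = πY := by
  have H : ∀ {W : Scheme.{u}} (g₁ g₂ : W ⟶ Spec (CommRingCat.of (polyQuot k p.1))),
      g₁ ≫ πX = g₂ ≫ πX → g₁ ≫ πY = g₂ ≫ πY := by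
    intro W g₁ g₂ h
    rw [← hX.lift_fst g₁ g₂ h, Category.assoc, hY.w, ← Category.assoc, hX.lift_snd]
  exact ⟨EffectiveEpi.desc πX πY H, EffectiveEpi.fac _ _ H⟩

theorem IsPresentedBy.nonempty_iso {k : Type u} [Field k] {X Y : Over (Spec (CommRingCat.of k))}
    {p : Presentation k} (hX : IsPresentedBy X p) (hY : IsPresentedBy Y p) : Nonempty (X ≅ Y) := by
  obtain ⟨πX, _, hX₁, hX₂⟩ := hX
  obtain ⟨πY, _, hY₁, hY₂⟩ := hY
  obtain ⟨f, hf⟩ := IsPresentedBy.exists_hom hX₂ hY₂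
  obtain ⟨g, hg⟩ := IsPresentedBy.exists_hom hY₂ hX₂
  refine ⟨Over.isoMk ⟨f, g, ?_, ?_⟩ ?_⟩
  · rw [← cancel_epi πX, reassoc_of% hf, hg, Category.comp_id]
  · rw [← cancel_epi πY, reassoc_of% hg, hf, Category.comp_id]
  · simp only
    rw [← cancel_epi πX, reassoc_of% hf, hX₁, hY₁]

theorem exists_isPresentedBy {k : Type u} [Field k] (X : Over (Spec (CommRingCat.of k)))
    (h₁ : IsSeparated X.hom) (h₂ : LocallyOfFiniteType X.hom) (h₃ : QuasiCompact X.hom) :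
    ∃ p, IsPresentedBy X p := by
  have : CompactSpace X.left := QuasiCompact.compactSpace_of_compactSpace X.hom
  have : X.left.IsSeparated :=
    ⟨by rw [← terminal.comp_from X.hom]; infer_instance⟩
  let 𝒰 := X.left.affineCover.finiteSubcover
  have (i : 𝒰.I₀) : IsAffine (𝒰.X i) := inferInstanceAs (IsAffine (X.left.affineCover.X _))
  let π : ∐ 𝒰.X ⟶ X.left := Sigma.desc 𝒰.f
  have hloc : IsZariskiLocalAtSource @LocallyOfFiniteType.{u} := by
    apply HasRingHomProperty.instIsZariskiLocalAtSource
  have : LocallyOfFiniteType π := IsZariskiLocalAtSource.sigmaDesc (P := @LocallyOfFiniteType) (f := 𝒰.f) fun _ ↦ inferInstance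
  have : Flat π := inferInstance
  have : Surjective π := inferInstance
  have : QuasiCompact π := inferInstance
  obtain ⟨a, ⟨ea⟩⟩ := exists_polyQuot_iso (π ≫ X.hom)
  have : IsAffineHom (π ≫ terminal.from X.left) := inferInstance
  have : IsAffineHom π := IsAffineHom.of_comp π (terminal.from X.left)
  have : IsAffineHom (pullback.fst π π) := inferInstance
  have : IsAffine (pullback π π) := isAffine_of_isAffineHom (pullback.fst π π)
  obtain ⟨b, ⟨eb⟩⟩ := exists_polyQuot_iso (pullback.fst π π ≫ π ≫ X.hom)
  obtain ⟨φ, hφ⟩ := Spec.homEquiv.symm.surjective (eb.hom ≫ pullback.fst π π ≫ ea.inv)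
  obtain ⟨ψ, hψ⟩ := Spec.homEquiv.symm.surjective (eb.hom ≫ pullback.snd π π ≫ ea.inv)
  obtain ⟨σ, hσ⟩ := Spec.homEquiv.symm.surjective (ea.hom ≫ π ≫ X.hom)
  refine ⟨⟨a, b, φ.hom, ψ.hom, σ.hom⟩, ea.hom ≫ π, inferInstance, ?_, ?_⟩
  · simpa using hσ.symm
  · refine IsPullback.of_iso (IsPullback.of_hasPullback π π) eb.symm ea.symm ea.symm (Iso.refl _)
      ?_ ?_ ?_ ?_
    · simp [← cancel_epi eb.hom]; exact hφ.symm
    · simp [← cancel_epi eb.hom]; exact hψ.symm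
    · simp
    · simp


theorem essentiallySmall_fullSubcategory {k : Type u} [Field k] (P : ObjectProperty (Over (Spec (CommRingCat.of k))))
    (hP : ∀ X, P X → IsSeparated X.hom ∧ LocallyOfFiniteType X.hom ∧ QuasiCompact X.hom) :
    EssentiallySmall.{u} P.FullSubcategory := by
  have h (X : P.FullSubcategory) : ∃ p, IsPresentedBy X.obj p :=
    exists_isPresentedBy X.obj (hP _ X.property).1 (hP _ X.property).2.1 (hP _ X.property).2.2
  choose p hp using h
  refine (essentiallySmall_iff _).2 ⟨?_, inferInstance⟩
  refine small_of_injective (β := Presentation k)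
    (f := fun X => p ((fromSkeleton _).obj X)) fun X Y hXY => ?_
  obtain ⟨e⟩ := IsPresentedBy.nonempty_iso (hp ((fromSkeleton _).obj X))
    (by have := hp ((fromSkeleton _).obj Y); simp only at hXY; rwa [← hXY] at this)
  have e' : (fromSkeleton _).obj X ≅ (fromSkeleton _).obj Y := P.isoMk e
  exact skeleton_skeletal _ ⟨(fromSkeleton P.FullSubcategory).preimageIso e'⟩


noncomputable section

/-- The separated schemes of finite type over `k` of Krull dimension at most `d`. -/
def schProp (k : Type u) [Field k] (d : ℕ∞) : ObjectProperty (Over (Spec (CommRingCat.of k))) :=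
  fun X => IsSeparated X.hom ∧ LocallyOfFiniteType X.hom ∧ QuasiCompact X.hom ∧
    topologicalKrullDim X.left ≤ (d : WithBot ℕ∞)

/-- The category `Sch^d/k` of separated schemes of finite type over `k`, of Krull dimension at
most `d`, with all morphisms over `k`; for `d = ⊤` there is no condition on the dimension. -/
abbrev Sch (k : Type u) [Field k] (d : ℕ∞) : Type (u + 1) :=
  (schProp k d).FullSubcategory

instance (k : Type u) [Field k] (d : ℕ∞) : EssentiallySmall.{u} (Sch k d) :=
  essentiallySmall_fullSubcategory (schProp k d) fun _ h => ⟨h.1, h.2.1, h.2.2.1⟩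

variable {k : Type u} [Field k] {d : ℕ∞}

/-- The underlying scheme of an object of `Sch^d/k`. -/
abbrev Sch.scheme (X : Sch k d) : Scheme.{u} := X.obj.left

/-- The underlying morphism of schemes of a morphism of `Sch^d/k`. -/
abbrev Sch.mor {X Y : Sch k d} (f : X ⟶ Y) : X.scheme ⟶ Y.scheme := f.hom.left

/-- Abstract blow-up squares: cartesian squares of schemes in which `f` is proper, `i` is a closed
embedding and `f` induces an isomorphism `X' - Z' ≅ X - Z`. -/
structure IsAbstractBlowUp {Z' X' Z X : Sch k d} (i' : Z' ⟶ X') (f' : Z' ⟶ Z)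
    (f : X' ⟶ X) (i : Z ⟶ X) : Prop where
  isPullback : IsPullback (Sch.mor i') (Sch.mor f') (Sch.mor f) (Sch.mor i)
  isProper : IsProper (Sch.mor f)
  isClosedImmersion : IsClosedImmersion (Sch.mor i)
  /-- As the square is cartesian, `X' - Z'` is the preimage under `f` of `U = X - Z`. -/
  isIso : ∃ U : X.scheme.Opens, (U : Set X.scheme) = (Set.range (Sch.mor i))ᶜ ∧
    IsIso (Sch.mor f ∣_ U)

/-- The families which generate the eh-topology: jointly surjective families of etale morphisms,
and the families `{f : X' ⟶ X, i : Z ⟶ X}` for the abstract blow-up squares. -/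
def ehPrecoverage (k : Type u) [Field k] (d : ℕ∞) : Precoverage (Sch k d) where
  coverings X :=
    { R | (∀ ⦃Y : Sch k d⦄ (g : Y ⟶ X), R g → Etale (Sch.mor g)) ∧
      ∀ x : X.scheme, ∃ (Y : Sch k d) (g : Y ⟶ X), R g ∧ x ∈ Set.range (Sch.mor g) } ∪
    { R | ∃ (Z' X' Z : Sch k d) (i' : Z' ⟶ X') (f' : Z' ⟶ Z) (f : X' ⟶ X) (i : Z ⟶ X),
      IsAbstractBlowUp i' f' f i ∧ R = Presieve.singleton f ⊔ Presieve.singleton i }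

/-- The eh-topology on `Sch^d/k`: the smallest Grothendieck topology for which the families above
are coverings. -/
def ehTopology (k : Type u) [Field k] (d : ℕ∞) : GrothendieckTopology (Sch k d) :=
  (ehPrecoverage k d).toGrothendieck

/-- Sheaves of abelian groups on `(Sch^d/k)_eh`. -/
abbrev EhSheaf (k : Type u) [Field k] (d : ℕ∞) : Type (u + 1) :=
  Sheaf (ehTopology k d) AddCommGrpCat.{u}

instance : HasSheafify (ehTopology k d) AddCommGrpCat.{u} :=
  hasSheafifyEssentiallySmallSite.{u} _ _

instance : IsGrothendieckAbelian.{u} (EhSheaf k d) :=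
  Sheaf.isGrothendieckAbelian_of_essentiallySmall _ _

/-- The functor of sections `F ↦ Γ(X_eh, F)`. -/
abbrev ehSections (X : Sch k d) : EhSheaf k d ⥤ AddCommGrpCat.{u} :=
  (sheafSections (ehTopology k d) AddCommGrpCat.{u}).obj (op X)

instance (X : Sch k d) : (ehSections X).Additive where

/-- The functor `F ↦ H^n(X_eh, F)`: the `n`th right derived functor of `F ↦ Γ(X_eh, F)`. -/
def ehCohomology (n : ℕ) (X : Sch k d) : EhSheaf k d ⥤ AddCommGrpCat.{u} :=
  (ehSections X).rightDerived n

/-- The pull-back `g^* : H^n(X_eh, F) → H^n(Y_eh, F)` along `g : Y ⟶ X`, induced by the restriction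
maps `Γ(X_eh, -) → Γ(Y_eh, -)`. -/
def ehPullback (n : ℕ) {X Y : Sch k d} (g : Y ⟶ X) (F : EhSheaf k d) :
    (ehCohomology n X).obj F →+ (ehCohomology n Y).obj F :=
  ((NatTrans.rightDerived
    ((sheafSections (ehTopology k d) AddCommGrpCat.{u}).map g.op) n).app F).hom

end

end EhTopology

/-! ### Homological algebra: from a cartesian square to a long exact sequence. -/

namespace HomologicalComplex

open CategoryTheory Limits

/-! Two facts about sections give the sequence. (1) Every eh-sheaf `F` turns an abstract blow-up
square into a cartesian square: `F(X) = F(Z) ×_{F(Z')} F(X')`. (2) If `I` is injective, then `I(X')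
→ I(Z')` is surjective, because `i'` is a monomorphism. So 0 → I(X) → I(Z) ⊕ I(X') → I(Z') → 0 is
exact for injective `I`; evaluated on an injective resolution of `F`, it is a short exact sequence
of complexes, whose homology sequence is the one sought.

For (1), `i` and `f` cover `X`, so a pair over `Z` and `X'` agreeing on `Z'` must be shown
compatible on all overlaps. The overlap of `X'` with itself is the hard one, as `X' ×_X X'` may have
dimension greater than `d`. Instead, given `a, b : T ⟶ X'` that agree over `X`, `T` is covered by
two closed subschemes: the equalizer of `a` and `b`, and the preimage of `Z`. These form another
abstract blow-up (`exists_isAbstractBlowUp_equalizing`), since `a = b` wherever `f` is an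
isomorphism. -/

/-- A commutative square of cochain complexes which is cartesian in each degree is cartesian. -/
lemma isPullback_of_eval {C ι : Type*} [Category* C] [HasZeroMorphisms C]
    {c : ComplexShape ι} {K₁ K₂ K₃ K₄ : HomologicalComplex C c}
    {a : K₁ ⟶ K₂} {b : K₁ ⟶ K₃} {p : K₂ ⟶ K₄} {q : K₃ ⟶ K₄} (w : a ≫ p = b ≫ q)
    (h : ∀ n, IsPullback (a.f n) (b.f n) (p.f n) (q.f n)) : IsPullback a b p q :=
  ⟨⟨w⟩, ⟨isLimitOfEval _ _ fun n =>
    (isLimitMapConePullbackConeEquiv (eval C c n) w).symm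
      (h n).isLimit⟩⟩

end HomologicalComplex

namespace CategoryTheory

open Limits

/-- A pullback is the kernel of the difference map, and that map is already epi on the summand `K₃`.
-/
lemma IsPullback.shortExact_shortComplex' {A : Type*} [Category* A] [Abelian A]
    {K₁ K₂ K₃ K₄ : A} {a : K₁ ⟶ K₂} {b : K₁ ⟶ K₃} {p : K₂ ⟶ K₄} {q : K₃ ⟶ K₄}
    (h : IsPullback a b p q) [Epi q] : h.toCommSq.shortComplex'.ShortExact where
  exact := ShortComplex.exact_of_f_is_kernel _ h.isLimitKernelFork
  mono_f := h.mono_shortComplex'_f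
  epi_g := by
    have : Epi (biprod.inr ≫ biprod.desc p (-q)) := by
      rw [biprod.inr_desc]
      infer_instance
    exact epi_of_epi biprod.inr (biprod.desc p (-q))

/-- There are no boundaries in degree 0, so the homology there is the subobject of cycles. -/
lemma mono_homologyMap_zero {A : Type*} [Category* A] [Abelian A] {K L : CochainComplex A ℕ}
    (φ : K ⟶ L) [Mono (φ.f 0)] : Mono (HomologicalComplex.homologyMap φ 0) := by
  have : Mono (HomologicalComplex.cyclesMap φ 0) := by
    have : Mono (HomologicalComplex.cyclesMap φ 0 ≫ L.iCycles 0) := by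
      rw [HomologicalComplex.cyclesMap_i]
      infer_instance
    exact mono_of_mono _ (L.iCycles 0)
  rw [← mono_comp_iff_of_isIso (K.homologyπ 0), HomologicalComplex.homologyπ_naturality]
  infer_instance

/-- The projections identify the homology of a biproduct with the product of the homologies. -/
noncomputable def homologyBiprodAddEquiv {ι : Type*} {c : ComplexShape ι}
    (K L : HomologicalComplex AddCommGrpCat.{u} c) (n : ι) :
    (K ⊞ L).homology n ≃+ K.homology n × L.homology n where
  toFun := (HomologicalComplex.homologyMap (biprod.fst : K ⊞ L ⟶ K) n).hom.prod
    (HomologicalComplex.homologyMap (biprod.snd : K ⊞ L ⟶ L) n).hom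
  invFun := (HomologicalComplex.homologyMap (biprod.inl : K ⟶ K ⊞ L) n).hom.coprod
    (HomologicalComplex.homologyMap (biprod.inr : L ⟶ K ⊞ L) n).hom
  left_inv x := by
    have h := congr(HomologicalComplex.homologyMap $(biprod.total (X := K) (Y := L)) n)
    rw [HomologicalComplex.homologyMap_add, HomologicalComplex.homologyMap_comp,
      HomologicalComplex.homologyMap_comp, HomologicalComplex.homologyMap_id] at h
    exact congr($h x)
  right_inv := by
    rintro ⟨y, z⟩
    simp [← ConcreteCategory.comp_apply, ← HomologicalComplex.homologyMap_comp]
  map_add' := map_add _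

/-- The long exact homology sequence of a cartesian square of cochain complexes of abelian groups
one of whose edges is an epimorphism. -/
theorem exists_long_exact_homology {K₁ K₂ K₃ K₄ : CochainComplex AddCommGrpCat.{u} ℕ}
    {a : K₁ ⟶ K₂} {b : K₁ ⟶ K₃} {p : K₂ ⟶ K₄} {q : K₃ ⟶ K₄} (h : IsPullback a b p q) [Epi q] :
    ∃ δ : ∀ n : ℕ, K₄.homology n →+ K₁.homology (n + 1),
      Function.Injective ((HomologicalComplex.homologyMap a 0).hom.prod
        (HomologicalComplex.homologyMap b 0).hom) ∧
      ∀ n : ℕ,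
        Function.Exact
          ((HomologicalComplex.homologyMap a n).hom.prod (HomologicalComplex.homologyMap b n).hom)
          ((HomologicalComplex.homologyMap p n).hom.coprod
            (-(HomologicalComplex.homologyMap q n).hom)) ∧
        Function.Exact
          ((HomologicalComplex.homologyMap p n).hom.coprod
            (-(HomologicalComplex.homologyMap q n).hom)) (δ n) ∧
        Function.Exact (δ n)
          ((HomologicalComplex.homologyMap a (n + 1)).hom.prod
            (HomologicalComplex.homologyMap b (n + 1)).hom) := by
  have hS := h.shortExact_shortComplex'
  let e (n : ℕ) := homologyBiprodAddEquiv K₂ K₃ n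
  let φ (n : ℕ) : K₁.homology n →+ (K₂ ⊞ K₃).homology n :=
    (HomologicalComplex.homologyMap (biprod.lift a b) n).hom
  let ψ (n : ℕ) : (K₂ ⊞ K₃).homology n →+ K₄.homology n :=
    (HomologicalComplex.homologyMap (biprod.desc p (-q)) n).hom
  let δ (n : ℕ) : K₄.homology n →+ K₁.homology (n + 1) := (hS.δ n (n + 1) rfl).hom
  have h₁ (n : ℕ) : Function.Exact (δ n) (φ (n + 1)) :=
    (ShortComplex.ab_exact_iff_function_exact _).1 (hS.homology_exact₁ n (n + 1) rfl)
  have h₂ (n : ℕ) : Function.Exact (φ n) (ψ n) :=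
    (ShortComplex.ab_exact_iff_function_exact _).1 (hS.homology_exact₂ n)
  have h₃ (n : ℕ) : Function.Exact (ψ n) (δ n) :=
    (ShortComplex.ab_exact_iff_function_exact _).1 (hS.homology_exact₃ n (n + 1) rfl)
  have hφ (n : ℕ) : (HomologicalComplex.homologyMap a n).hom.prod
      (HomologicalComplex.homologyMap b n).hom = (e n : _ →+ _).comp (φ n) := by
    ext x
    · exact congr($(show HomologicalComplex.homologyMap a n = HomologicalComplex.homologyMap
        (biprod.lift a b) n ≫ HomologicalComplex.homologyMap biprod.fst n by
          rw [← HomologicalComplex.homologyMap_comp, biprod.lift_fst]) x)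
    · exact congr($(show HomologicalComplex.homologyMap b n = HomologicalComplex.homologyMap
        (biprod.lift a b) n ≫ HomologicalComplex.homologyMap biprod.snd n by
          rw [← HomologicalComplex.homologyMap_comp, biprod.lift_snd]) x)
  have hψ (n : ℕ) : (HomologicalComplex.homologyMap p n).hom.coprod
      (-(HomologicalComplex.homologyMap q n).hom) = (ψ n).comp ((e n).symm : _ →+ _) := by
    have hp := show HomologicalComplex.homologyMap biprod.inl n ≫ HomologicalComplex.homologyMap
      (biprod.desc p (-q)) n = HomologicalComplex.homologyMap p n by
        rw [← HomologicalComplex.homologyMap_comp, biprod.inl_desc]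
    have hq := show HomologicalComplex.homologyMap biprod.inr n ≫ HomologicalComplex.homologyMap
      (biprod.desc p (-q)) n = -HomologicalComplex.homologyMap q n by
        rw [← HomologicalComplex.homologyMap_comp, biprod.inr_desc,
          HomologicalComplex.homologyMap_neg]
    ext ⟨y, z⟩
    refine (congr_arg₂ (· + ·) congr($hp y) congr($hq z)).symm.trans ?_
    exact (map_add (ψ n) _ _).symm
  have hinj : Function.Injective (φ 0) := by
    have : Mono (biprod.lift a b) := hS.mono_f
    exact (AddCommGrpCat.mono_iff_injective _).1 (mono_homologyMap_zero (biprod.lift a b))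
  -- Up to the identifications `e`, the maps in the goal are those of the homology sequence of `hS`.
  simp only [hφ, hψ]
  refine ⟨δ, (e 0).injective.comp hinj, fun n => ⟨?_, ?_, ?_⟩⟩
  · exact (Function.Exact.iff_of_ladder_addEquiv (.refl _) (e n) (.refl _) (f₁₂ := φ n)
      (f₂₃ := ψ n) rfl (by ext x; simp)).2 (h₂ n)
  · exact (Function.Exact.iff_of_ladder_addEquiv (e n) (.refl _) (.refl _) (f₁₂ := ψ n)
      (f₂₃ := δ n) (by ext x; simp) rfl).2 (h₃ n)
  · exact (Function.Exact.iff_of_ladder_addEquiv (.refl _) (.refl _) (e (n + 1)) (f₁₂ := δ n)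
      (f₂₃ := φ (n + 1)) rfl rfl).2 (h₁ n)

variable {C : Type*} [Category* C] [Abelian C] [HasInjectiveResolutions C]

/-- The long exact sequence of right derived functors attached to a square of additive functors
which is cartesian on injective objects, one edge of which is an epimorphism on injectives. -/
theorem exists_long_exact_rightDerived {G₁ G₂ G₃ G₄ : C ⥤ AddCommGrpCat.{u}}
    [G₁.Additive] [G₂.Additive] [G₃.Additive] [G₄.Additive]
    {a : G₁ ⟶ G₂} {b : G₁ ⟶ G₃} {p : G₂ ⟶ G₄} {q : G₃ ⟶ G₄} (w : a ≫ p = b ≫ q)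
    (h : ∀ I : C, Injective I → IsPullback (a.app I) (b.app I) (p.app I) (q.app I))
    (hq : ∀ I : C, Injective I → Epi (q.app I)) (X : C) :
    ∃ δ : ∀ n : ℕ, (G₄.rightDerived n).obj X →+ (G₁.rightDerived (n + 1)).obj X,
      Function.Injective (((NatTrans.rightDerived a 0).app X).hom.prod
        ((NatTrans.rightDerived b 0).app X).hom) ∧
      ∀ n : ℕ,
        Function.Exact
          (((NatTrans.rightDerived a n).app X).hom.prod ((NatTrans.rightDerived b n).app X).hom)
          (((NatTrans.rightDerived p n).app X).hom.coprod
            (-((NatTrans.rightDerived q n).app X).hom)) ∧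
        Function.Exact
          (((NatTrans.rightDerived p n).app X).hom.coprod
            (-((NatTrans.rightDerived q n).app X).hom)) (δ n) ∧
        Function.Exact (δ n)
          (((NatTrans.rightDerived a (n + 1)).app X).hom.prod
            ((NatTrans.rightDerived b (n + 1)).app X).hom) := by
  -- One resolution computes all four derived functors, so the hypotheses apply degree by degree.
  let P := injectiveResolution X
  let m {F G : C ⥤ AddCommGrpCat.{u}} [F.Additive] [G.Additive] (α : F ⟶ G) :=
    (NatTrans.mapHomologicalComplex α (ComplexShape.up ℕ)).app P.cocomplex
  have : Epi (m q) := by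
    have (n : ℕ) : Epi ((m q).f n) := hq _ (P.injective n)
    exact HomologicalComplex.epi_of_epi_f _ inferInstance
  have hP : IsPullback (m a) (m b) (m p) (m q) := by
    refine HomologicalComplex.isPullback_of_eval ?_ fun n => h _ (P.injective n)
    ext1 n
    exact congr(($w).app (P.cocomplex.X n))
  obtain ⟨δ, h₀, h₁⟩ := exists_long_exact_homology hP
  let e (F : C ⥤ AddCommGrpCat.{u}) [F.Additive] (n : ℕ) :
      (F.rightDerived n).obj X ≃+ ((F.mapHomologicalComplex (ComplexShape.up ℕ)).obj
        P.cocomplex).homology n :=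
    (P.isoRightDerivedObj F n).addCommGroupIsoToAddEquiv
  -- The comparison `e` is natural in the functor, so exactness transports along it.
  have he {F G : C ⥤ AddCommGrpCat.{u}} [F.Additive] [G.Additive] (α : F ⟶ G) (n : ℕ)
      (x : (F.rightDerived n).obj X) : HomologicalComplex.homologyMap (m α) n (e F n x) =
        e G n (((NatTrans.rightDerived α n).app X).hom x) := by
    have h := P.rightDerived_app_eq α n
    rw [← Category.assoc, Iso.eq_comp_inv] at h
    exact congr($h.symm x)
  have hpq (n : ℕ) (y : (G₂.rightDerived n).obj X × (G₃.rightDerived n).obj X) :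
      ((HomologicalComplex.homologyMap (m p) n).hom.coprod
        (-(HomologicalComplex.homologyMap (m q) n).hom)) ((e G₂ n).prodCongr (e G₃ n) y) =
      e G₄ n ((((NatTrans.rightDerived p n).app X).hom.coprod
        (-((NatTrans.rightDerived q n).app X).hom)) y) := by
    simp only [AddMonoidHom.coprod_apply, AddMonoidHom.neg_apply, map_add, map_neg, ← he]
    rfl
  refine ⟨fun n => ((e G₁ (n + 1)).symm : _ →+ _).comp ((δ n).comp (e G₄ n : _ →+ _)),
    ?_, fun n => ⟨?_, ?_, ?_⟩⟩
  · refine .of_comp (f := (e G₂ 0).prodCongr (e G₃ 0)) ?_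
    convert h₀.comp (e G₁ 0).injective using 1
    ext1 x
    exact Prod.ext (he a 0 x).symm (he b 0 x).symm
  · refine (Function.Exact.iff_of_ladder_addEquiv (e G₁ n) ((e G₂ n).prodCongr (e G₃ n)) (e G₄ n)
      ?_ ?_).1 (h₁ n).1
    · ext x
      · exact he a n x
      · exact he b n x
    · ext1 y; exact hpq n y
  · refine (Function.Exact.iff_of_ladder_addEquiv ((e G₂ n).prodCongr (e G₃ n)) (e G₄ n)
      (e G₁ (n + 1)) ?_ ?_).1 (h₁ n).2.1
    · ext1 y; exact hpq n y
    · ext; simp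
  · refine (Function.Exact.iff_of_ladder_addEquiv (e G₄ n) (e G₁ (n + 1))
      ((e G₂ (n + 1)).prodCongr (e G₃ (n + 1))) ?_ ?_).1 (h₁ n).2.2
    · ext; simp
    · ext x
      · exact he a _ x
      · exact he b _ x

end CategoryTheory

/-! ### Sheaves on abstract blow-up squares. -/

namespace EhTopology

open CategoryTheory Limits AlgebraicGeometry Opposite

lemma eq_of_comp_eq_of_isIso_morphismRestrict {W X Y : Scheme.{u}} (f : X ⟶ Y) (V : Y.Opens)
    [IsIso (f ∣_ V)] {a b : W ⟶ X} (h : a ≫ f = b ≫ f)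
    (ha : Set.range (a ≫ f) ⊆ V) : a = b := by
  have hb : Set.range (b ≫ f) ⊆ V := h ▸ ha
  have aux : ∀ c : W ⟶ X, Set.range (c ≫ f) ⊆ V → Set.range c ⊆ Set.range (f ⁻¹ᵁ V).ι := by
    rintro c hc _ ⟨w, rfl⟩
    rw [Scheme.Opens.range_ι]
    exact hc ⟨w, by simp⟩
  rw [← IsOpenImmersion.lift_fac (f ⁻¹ᵁ V).ι a (aux a ha),
    ← IsOpenImmersion.lift_fac (f ⁻¹ᵁ V).ι b (aux b hb)]
  congr 1
  rw [← cancel_mono (f ∣_ V), ← cancel_mono V.ι]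
  simpa using h

/-- The base change of `j` to `U` is a monomorphism, and `s` gives it a section. -/
lemma isIso_morphismRestrict_of_mono {E T : Scheme.{u}} (j : E ⟶ T) [Mono j] (U : T.Opens)
    (s : U.toScheme ⟶ E) (hs : s ≫ j = U.ι) : IsIso (j ∣_ U) := by
  have hP := isPullback_morphismRestrict j U
  have : Mono (j ∣_ U) := MorphismProperty.of_isPullback (P := .monomorphisms _) hP.flip ‹Mono j›
  have : IsSplitEpi (j ∣_ U) := ⟨⟨hP.lift (𝟙 _) s (by simp [hs]), by simp⟩⟩
  exact isIso_of_mono_of_isSplitEpi _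

noncomputable section

variable {k : Type u} [Field k] {d : ℕ∞}

/-- Closed subschemes inherit the dimension bound, which keeps the auxiliary schemes below in
`Sch^d/k`. -/
lemma schProp_of_isClosedImmersion {X : Sch k d} {Y : Over (Spec (CommRingCat.of k))}
    (j : Y ⟶ X.obj) [IsClosedImmersion j.left] : schProp k d Y := by
  obtain ⟨h₁, h₂, h₃, h₄⟩ := X.property
  have hj : Y.hom = j.left ≫ X.obj.hom := (Over.w j).symm
  refine ⟨?_, ?_, ?_, (j.left.isClosedEmbedding.isInducing.topologicalKrullDim_le).trans h₄⟩
  all_goals rw [hj]; infer_instance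

/-- A cartesian square of schemes over `k` is cartesian in `Sch^d/k`. -/
lemma isPullback_of_isPullback_mor {P X Y S : Sch k d} {p : P ⟶ X} {q : P ⟶ Y} {f : X ⟶ S}
    {g : Y ⟶ S} (h : IsPullback (Sch.mor p) (Sch.mor q) (Sch.mor f) (Sch.mor g)) :
    IsPullback p q f g := by
  have h₁ : IsPullback p.hom q.hom f.hom g.hom :=
    IsPullback.of_map (Over.forget _) (by ext1; exact h.w) h
  exact IsPullback.of_map (ObjectProperty.ι _) (by ext1; exact h₁.w) h₁

/-- Two morphisms into `X'` which agree over `X` are equalized by a closed subscheme which, together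
with the preimage of `Z`, covers their source. -/
lemma exists_isAbstractBlowUp_equalizing {Z' X' Z X T : Sch k d} {i' : Z' ⟶ X'} {f' : Z' ⟶ Z}
    {f : X' ⟶ X} {i : Z ⟶ X} (h : IsAbstractBlowUp i' f' f i) {a b : T ⟶ X'}
    (hab : a ≫ f = b ≫ f) :
    ∃ (D' E D : Sch k d) (j' : D' ⟶ E) (g' : D' ⟶ D) (g : E ⟶ T) (j : D ⟶ T) (z : D ⟶ Z),
      IsAbstractBlowUp j' g' g j ∧ g ≫ a = g ≫ b ∧ j ≫ a ≫ f = z ≫ i := by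
  have := h.isClosedImmersion
  obtain ⟨U, hU, _⟩ := h.isIso
  -- Separatedness of `X'` makes the equalizer of `a` and `b` a closed subscheme of `T`.
  have : IsSeparated X'.obj.hom := X'.property.1
  let g₀ := equalizer.ι a.hom b.hom
  let j₀ : pullback (a ≫ f).hom i.hom ⟶ T.obj := pullback.fst _ _
  have hj₀ : IsPullback j₀.left (pullback.snd (a ≫ f).hom i.hom).left (a ≫ f).hom.left i.hom.left :=
    (IsPullback.of_hasPullback (a ≫ f).hom i.hom).map (Over.forget _)
  have : IsClosedImmersion j₀.left := MorphismProperty.of_isPullback hj₀.flip inferInstance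
  have hP := (IsPullback.of_hasPullback g₀ j₀).map (Over.forget _)
  have : IsClosedImmersion (pullback.fst g₀ j₀).left := MorphismProperty.of_isPullback hP.flip
    (inferInstanceAs (IsClosedImmersion j₀.left))
  let E : Sch k d := ⟨_, schProp_of_isClosedImmersion g₀⟩
  let D : Sch k d := ⟨_, schProp_of_isClosedImmersion j₀⟩
  let D' : Sch k d := ⟨_, schProp_of_isClosedImmersion (X := E) (pullback.fst g₀ j₀)⟩
  let V : T.scheme.Opens := (Sch.mor (a ≫ f)) ⁻¹ᵁ U
  -- `D` is the preimage of `Z` in `T`, so its complement is the preimage of `U`.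
  have hV : ∀ t, t ∈ V ↔ t ∉ Set.range j₀.left := by
    intro t
    have hr := Scheme.image_preimage_eq_of_isPullback hj₀.flip Set.univ
    rw [Set.preimage_univ, Set.image_univ, Set.image_univ] at hr
    have hU' (x : X.scheme) : x ∈ U ↔ x ∉ Set.range (Sch.mor i) := Set.ext_iff.1 hU x
    rw [hr]
    exact hU' _
  have hs : V.ι ≫ a.hom.left = V.ι ≫ b.hom.left := by
    refine eq_of_comp_eq_of_isIso_morphismRestrict (Sch.mor f) U ?_ ?_
    · simpa using! congr(V.ι ≫ Sch.mor $hab)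
    · rintro _ ⟨w, rfl⟩
      exact w.2
  -- As `a = b` on `V`, the inclusion of `V` factors through the equalizer, which therefore contains
  -- `V`.
  let s : Over.mk (V.ι ≫ T.obj.hom) ⟶ equalizer a.hom b.hom :=
    equalizer.lift (Over.homMk V.ι) (by ext1; exact hs)
  refine ⟨D', E, D, ⟨pullback.fst g₀ j₀⟩, ⟨pullback.snd g₀ j₀⟩, ⟨g₀⟩, ⟨j₀⟩,
    ⟨pullback.snd (a ≫ f).hom i.hom⟩, ⟨hP, ?_, ?_, V, ?_, ?_⟩, ?_, ?_⟩
  · exact inferInstanceAs (IsProper g₀.left)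
  · exact inferInstanceAs (IsClosedImmersion j₀.left)
  · ext t
    exact hV t
  · exact isIso_morphismRestrict_of_mono g₀.left V s.left
      (by rw [← Over.comp_left, equalizer.lift_ι]; rfl)
  · ext1
    exact equalizer.condition _ _
  · ext1
    exact pullback.condition

lemma ofTwoArrows_mem_ehTopology {Z' X' Z X : Sch k d} {i' : Z' ⟶ X'} {f' : Z' ⟶ Z}
    {f : X' ⟶ X} {i : Z ⟶ X} (h : IsAbstractBlowUp i' f' f i) :
    Sieve.ofTwoArrows i f ∈ ehTopology k d X := by
  refine (ehTopology k d).superset_covering ?_ (Precoverage.generate_mem_toGrothendieck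
    (J := ehPrecoverage k d) (Or.inr ⟨Z', X', Z, i', f', f, i, h, rfl⟩))
  rw [Sieve.generate_le_iff]
  rintro Y g (⟨⟨⟩⟩ | ⟨⟨⟩⟩)
  · exact Sieve.ofArrows_mk _ _ WalkingPair.right
  · exact Sieve.ofArrows_mk _ _ WalkingPair.left

/-- By cartesianness `a` and `b` factor through a common morphism `T ⟶ Z'`, where `s` and `t` agree.
-/
lemma comp_map_eq_comp_map {A : Type*} [Category* A] (F : Sheaf (ehTopology k d) A)
    {Z' X' Z X T : Sch k d} {i' : Z' ⟶ X'} {f' : Z' ⟶ Z} {f : X' ⟶ X} {i : Z ⟶ X}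
    (h : IsAbstractBlowUp i' f' f i) {a : T ⟶ X'} {b : T ⟶ Z} (hab : a ≫ f = b ≫ i) {E : A}
    {s : E ⟶ F.obj.obj (op X')} {t : E ⟶ F.obj.obj (op Z)}
    (hst : t ≫ F.obj.map f'.op = s ≫ F.obj.map i'.op) :
    s ≫ F.obj.map a.op = t ≫ F.obj.map b.op := by
  obtain ⟨φ, rfl, rfl⟩ := (isPullback_of_isPullback_mor h.isPullback).exists_lift _ _ hab
  simpa using hst.symm =≫ F.obj.map φ.op

/-- Sections over `X'` whose restriction to `Z'` comes from `Z` have the same pull-back along any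
two morphisms which agree over `X`. -/
lemma comp_map_eq_of_comp_eq {A : Type*} [Category* A] (F : Sheaf (ehTopology k d) A)
    {Z' X' Z X T : Sch k d} {i' : Z' ⟶ X'} {f' : Z' ⟶ Z} {f : X' ⟶ X} {i : Z ⟶ X}
    (h : IsAbstractBlowUp i' f' f i) {a b : T ⟶ X'} (hab : a ≫ f = b ≫ f) {E : A}
    {s : E ⟶ F.obj.obj (op X')} {t : E ⟶ F.obj.obj (op Z)}
    (hst : t ≫ F.obj.map f'.op = s ≫ F.obj.map i'.op) :
    s ≫ F.obj.map a.op = s ≫ F.obj.map b.op := by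
  obtain ⟨D', E, D, j', g', g, j, z, hD, hg, hz⟩ := exists_isAbstractBlowUp_equalizing h hab
  refine F.2.hom_ext_ofArrows _ (ofTwoArrows_mem_ehTopology hD) ?_
  rintro (_ | _)
  -- On `D`, both pull-backs of `s` equal the pull-back of `t` along `z`. The other case is the
  -- equalizer, where `a` and `b` coincide.
  · simpa using (comp_map_eq_comp_map F h (a := j ≫ a) (b := z) (by simpa using hz) hst).trans
      (comp_map_eq_comp_map F h (a := j ≫ b) (b := z) (by simpa [← hab] using hz) hst).symm
  · simpa using congr(s ≫ F.obj.map ($hg).op)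

/-- The commutative square in `Sch^d/k` underlying an abstract blow-up square. -/
@[simps]
def IsAbstractBlowUp.square {Z' X' Z X : Sch k d} {i' : Z' ⟶ X'} {f' : Z' ⟶ Z}
    {f : X' ⟶ X} {i : Z ⟶ X} (h : IsAbstractBlowUp i' f' f i) : Square (Sch k d) where
  f₁₂ := f'
  f₁₃ := i'
  f₂₄ := i
  f₃₄ := f
  fac := (isPullback_of_isPullback_mor h.isPullback).w.symm

instance : HasWeakSheafify (ehTopology k d) (Type u) :=
  have : HasSheafify (ehTopology k d) (Type u) := hasSheafifyEssentiallySmallSite.{u} _ _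
  inferInstance

lemma IsAbstractBlowUp.mono_right {Z' X' Z X : Sch k d} {i' : Z' ⟶ X'} {f' : Z' ⟶ Z}
    {f : X' ⟶ X} {i : Z ⟶ X} (h : IsAbstractBlowUp i' f' f i) : Mono i :=
  have := h.isClosedImmersion
  have : Mono ((ObjectProperty.ι _ ⋙ Over.forget _).map i) := inferInstanceAs (Mono (Sch.mor i))
  (ObjectProperty.ι (schProp k d) ⋙ Over.forget _).mono_of_mono_map this

/-- Abstract blow-up squares are Mayer-Vietoris squares for the eh-topology. -/
def IsAbstractBlowUp.mayerVietorisSquare {Z' X' Z X : Sch k d} {i' : Z' ⟶ X'} {f' : Z' ⟶ Z}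
    {f : X' ⟶ X} {i : Z ⟶ X} (h : IsAbstractBlowUp i' f' f i) :
    (ehTopology k d).MayerVietorisSquare :=
  have : Mono i := h.mono_right
  have : Mono h.square.f₁₃ := MorphismProperty.of_isPullback (P := .monomorphisms _)
    (isPullback_of_isPullback_mor h.isPullback).flip ‹Mono i›
  .mk' h.square fun F => by
    have hJ := ofTwoArrows_mem_ehTopology h
    apply Square.IsPullback.mk
    refine PullbackCone.IsLimit.mk _ (fun s ↦ F.2.amalgamateOfArrows _ hJ
        (fun j ↦ WalkingPair.casesOn j s.fst s.snd) fun W ↦ ?_)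
      (fun _ ↦ F.2.amalgamateOfArrows_map _ _ _ _ WalkingPair.left)
      (fun _ ↦ F.2.amalgamateOfArrows_map _ _ _ _ WalkingPair.right) fun s m hm₁ hm₂ ↦ ?_
    -- The four overlaps, with left for `Z` and right for `X'`: `Z` with itself is trivial since `i`
    -- is mono, the mixed ones factor through `Z'`, and `X'` with itself uses the equalizer cover.
    · rintro (_ | _) (_ | _) a b fac
      · obtain rfl : a = b := (cancel_mono i).1 fac
        rfl
      · exact (comp_map_eq_comp_map F h fac.symm s.condition).symm
      · exact comp_map_eq_comp_map F h fac s.condition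
      · exact comp_map_eq_of_comp_eq F h fac s.condition
    · apply F.2.hom_ext_ofArrows _ hJ
      rintro (_ | _)
      · rw [F.2.amalgamateOfArrows_map _ _ _ _ WalkingPair.left]
        exact hm₁
      · rw [F.2.amalgamateOfArrows_map _ _ _ _ WalkingPair.right]
        exact hm₂

end

end EhTopology

/-! ### Restriction maps of injective sheaves. -/

namespace CategoryTheory

open Limits Opposite

/-- Sections over `W` are morphisms from the sheafified free abelian presheaf on `W`. A monomorphism
`j` induces a monomorphism of these sheaves, so morphisms into an injective sheaf extend along it.
-/
lemma Sheaf.epi_map_of_injective {C : Type*} [Category.{u} C] {J : GrothendieckTopology C}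
    [HasSheafify J AddCommGrpCat.{u}] (I : Sheaf J AddCommGrpCat.{u}) [Injective I] {Y X : C}
    (j : Y ⟶ X) [Mono j] : Epi (I.obj.map j.op) := by
  rw [AddCommGrpCat.epi_iff_surjective]
  intro s
  let adj := (AddCommGrpCat.adj.whiskerRight Cᵒᵖ).comp
    (sheafificationAdjunction J AddCommGrpCat.{u})
  let e (W : C) := (adj.homEquiv (yoneda.obj W) I).trans yonedaEquiv
  have : Mono ((presheafToSheaf J AddCommGrpCat.{u}).map
    (Functor.whiskerRight (yoneda.map j) AddCommGrpCat.free)) := inferInstance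
  let g : (presheafToSheaf J AddCommGrpCat.{u}).obj (yoneda.obj X ⋙ AddCommGrpCat.free) ⟶ I :=
    Injective.factorThru ((e Y).symm s) ((presheafToSheaf J AddCommGrpCat.{u}).map
      (Functor.whiskerRight (yoneda.map j) AddCommGrpCat.free))
  have hg : (presheafToSheaf J AddCommGrpCat.{u}).map
      (Functor.whiskerRight (yoneda.map j) AddCommGrpCat.free) ≫ g = (e Y).symm s :=
    Injective.comp_factorThru _ _
  refine ⟨e X g, ?_⟩
  rw [← (e Y).apply_symm_apply s, ← hg]
  exact (yonedaEquiv_naturality _ _).trans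
    (congrArg yonedaEquiv (adj.homEquiv_naturality_left (yoneda.map j) g).symm)

end CategoryTheory

/-! ### The long exact sequence of an abstract blow-up. -/

namespace EhTopology

open CategoryTheory Limits AlgebraicGeometry Opposite

variable {k : Type u} [Field k] {d : ℕ∞}

/-- The Mayer-Vietoris property, checked on sheaves of sets, carries over to sheaves of abelian
groups. -/
lemma IsAbstractBlowUp.isPullback_sections {Z' X' Z X : Sch k d} {i' : Z' ⟶ X'} {f' : Z' ⟶ Z}
    {f : X' ⟶ X} {i : Z ⟶ X} (h : IsAbstractBlowUp i' f' f i) (F : EhSheaf k d) :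
    IsPullback (F.obj.map i.op) (F.obj.map f.op) (F.obj.map f'.op) (F.obj.map i'.op) :=
  h.mayerVietorisSquare.sheafCondition_of_sheaf F

end EhTopology

theorem mainTheorem9 {k : Type u} [Field k] [PerfectField k] {d : ℕ∞}
    {Z' X' Z X : EhTopology.Sch k d} (i' : Z' ⟶ X') (f' : Z' ⟶ Z) (f : X' ⟶ X) (i : Z ⟶ X)
    (h : EhTopology.IsAbstractBlowUp i' f' f i) (F : EhTopology.EhSheaf k d) :
    ∃ δ : ∀ n : ℕ,
        (EhTopology.ehCohomology n Z').obj F →+ (EhTopology.ehCohomology (n + 1) X).obj F,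
      Function.Injective ((EhTopology.ehPullback 0 i F).prod (EhTopology.ehPullback 0 f F)) ∧
      ∀ n : ℕ,
        Function.Exact
          ((EhTopology.ehPullback n i F).prod (EhTopology.ehPullback n f F))
          ((EhTopology.ehPullback n f' F).coprod (-EhTopology.ehPullback n i' F)) ∧
        Function.Exact
          ((EhTopology.ehPullback n f' F).coprod (-EhTopology.ehPullback n i' F))
          (δ n) ∧
        Function.Exact
          (δ n)
          ((EhTopology.ehPullback (n + 1) i F).prod (EhTopology.ehPullback (n + 1) f F)) := by
  have : CategoryTheory.Mono i' := h.mayerVietorisSquare.mono_f₁₃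
  let σ := CategoryTheory.sheafSections (EhTopology.ehTopology k d) AddCommGrpCat.{u}
  -- The edge `q`, which must be epi on injectives, is restriction along the monomorphism `i'`.
  refine CategoryTheory.exists_long_exact_rightDerived (a := σ.map i.op) (b := σ.map f.op)
    (p := σ.map f'.op) (q := σ.map i'.op) ?_ (fun I _ => h.isPullback_sections I)
    (fun I _ => CategoryTheory.Sheaf.epi_map_of_injective I i') F
  simp only [← CategoryTheory.Functor.map_comp, ← CategoryTheory.op_comp]
  exact congrArg (fun g => σ.map g.op) h.square.fac
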